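/- Let $G$ be a finite group. A \emph{spherical system of generators} of $G$ is a tuple $T=(g_1,\dots,g_r)$ of non-trivial elements of $G$ with $\langle g_1,\dots,g_r\rangle=G$ and $g_1g_2\cdots g_r=1$; put $$\Sigma(T)=\bigcup_{g\in G}\bigcup_{i=1}^{r} g^{-1}\langle g_i\rangle g .$$ A \emph{ramification structure} of size $(r_1,r_2)$ for $G$ is a pair $(T_1,T_2)$ of spherical systems of generators of $G$, of lengths $r_1$ and $r_2$, such that $\Sigma(T_1)\cap\Sigma(T_2)=\{1\}$; $G$ \emph{admits a ramification structure} if it has one of some size $(r_1,r_2)$. For every prime $p\ge 5$ and every positive integer $m$ there exists a finite $p$-group $G$ with the following properties: the minimum number of generators of $G$ is $2$; if $\exp G=p^{e}$, then $e\ge 1$ and $|\{g^{p^{e-1}} \mid g\in G\}|=p^{m}$; and $G$ does not admit a ramification structure. -/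

import Mathlib

/-- A tuple `T = (g₁, …, g_r)` of non-trivial elements of `G` (given as a list) is a spherical
system of generators of `G` if it generates `G` and `g₁ g₂ ⋯ g_r = 1`. -/
structure IsSphericalSystem {G : Type*} [Group G] (T : List G) : Prop where
  ne_one : ∀ x ∈ T, x ≠ 1
  closure_eq_top : Subgroup.closure {x : G | x ∈ T} = ⊤
  prod_eq_one : T.prod = 1

/-- `Σ(T)`: the union of all conjugates of the cyclic subgroups generated by the elements
of the tuple `T`. -/
def sigmaSet {G : Type*} [Group G] (T : List G) : Set G :=
  ⋃ g : G, ⋃ x ∈ T, {y : G | ∃ z ∈ Subgroup.zpowers x, y = g⁻¹ * z * g}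

/-- `(T₁, T₂)` is an (unmixed) ramification structure of size `(r₁, r₂)` for `G`: both are spherical
systems of generators of `G`, of lengths `r₁` and `r₂`, and they are disjoint, that is,
`Σ(T₁) ∩ Σ(T₂) = 1`. -/
structure IsRamificationStructure {G : Type*} [Group G] (r₁ r₂ : ℕ) (T₁ T₂ : List G) : Prop where
  left_spherical : IsSphericalSystem T₁
  right_spherical : IsSphericalSystem T₂
  left_length : T₁.length = r₁
  right_length : T₂.length = r₂
  disjoint : sigmaSet T₁ ∩ sigmaSet T₂ = {1}

/-- The group `G` admits a ramification structure (of some size). -/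
def AdmitsRamificationStructure (G : Type*) [Group G] : Prop :=
  ∃ (r₁ r₂ : ℕ) (T₁ T₂ : List G), IsRamificationStructure r₁ r₂ T₁ T₂

/-!
Let `C` be cyclic of order `p ^ (m + 2)`, acting on `M = ℤ[ζ] / (p ^ (m + 2) * (ζ - 1) ^ m)`
through powers of a root of unity `ζ` of order `p ^ (m + 1)`, and let `G = M ⋊ C`. If `x ∈ C` acts
as multiplication by `v ≠ 1` and `v ^ n = 1`, then `1 + v + ⋯ + v ^ (n - 1) = 0` since `ℤ[ζ]` is a
domain, so the `n`-th power of `(a, x)` is `(0, x ^ n)`, whatever `a` is. Two consequences: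

* Every element of `G` over a generator of `C` has the subgroup of order `p` of `C` among its
  powers. A generating tuple contains such an element, so no two sets `Σ(T)` meet trivially.
* The `p ^ (m + 2)`-th powers in `G` are those in `M`. They form a copy of `ℤ[ζ] / (ζ - 1) ^ m`,
  which has `p ^ m` elements and is killed by `p` because `(ζ - 1) ^ m` divides `p`.

The group is generated by `1 ∈ M` and a generator of `C`, because `ζ` generates the ring `ℤ[ζ]`.
-/

section Groups

variable {G : Type*} [Group G]

theorem two_le_rank_of_not_commute [Group.FG G] {x y : G} (h : ¬ Commute x y) :
    2 ≤ Group.rank G := by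
  by_contra! hlt
  obtain ⟨S, hcard, hS⟩ := Group.rank_spec G
  have hcyclic : ∃ g : G, Subgroup.zpowers g = ⊤ := by
    obtain hzero | hone : S.card = 0 ∨ S.card = 1 := by omega
    · exact ⟨1, by simpa [Finset.card_eq_zero.1 hzero] using hS⟩
    · obtain ⟨g, rfl⟩ := Finset.card_eq_one.1 hone
      exact ⟨g, by simpa [Subgroup.zpowers_eq_closure] using hS⟩
  have : IsCyclic G := isCyclic_iff_exists_zpowers_eq_top.2 hcyclic
  exact h (mul_comm' x y)

theorem exponent_eq_prime_pow_of_one_lt_ncard {p l : ℕ} [Fact p.Prime]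
    (hG : ∀ g : G, g ^ p ^ (l + 1) = 1)
    (hl : 1 < (Set.range fun g : G => g ^ p ^ l).ncard) : Monoid.exponent G = p ^ (l + 1) := by
  obtain ⟨_, ⟨g, rfl⟩, hg⟩ := Set.exists_ne_of_one_lt_ncard hl 1
  exact Nat.dvd_antisymm (Monoid.exponent_dvd_of_forall_pow_eq_one hG)
    (orderOf_eq_prime_pow hg (hG g) ▸ Monoid.order_dvd_exponent g)

theorem zpowers_eq_top_of_pow_ne_one {p k : ℕ} [Fact p.Prime] (hG : Nat.card G = p ^ (k + 1))
    {x : G} (hx : x ^ p ^ k ≠ 1) : Subgroup.zpowers x = ⊤ := by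
  have : Finite G := Nat.finite_of_card_ne_zero (hG ▸ NeZero.ne _)
  rw [← Subgroup.card_eq_iff_eq_top, Nat.card_zpowers, hG]
  exact orderOf_eq_prime_pow hx (hG ▸ pow_card_eq_one')

theorem exists_zpowers_eq_top_and_monoidHom_apply_eq [IsCyclic G] {A : Type*} [Monoid A] {a : A}
    {n : ℕ} (hn : n ≠ 0) (hdvd : n ∣ Nat.card G) (ha : a ^ n = 1) :
    ∃ (c : G) (χ : G →* Aˣ), Subgroup.zpowers c = ⊤ ∧ (χ c : A) = a ∧ ∀ x, χ x ^ n = 1 := by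
  obtain ⟨c, hc⟩ := IsCyclic.exists_generator (α := G)
  let u : Aˣ := Units.ofPowEqOne a n ha hn
  have hu : u ^ n = 1 := Units.pow_ofPowEqOne ha hn
  have huc : orderOf u ∣ orderOf c :=
    orderOf_eq_card_of_forall_mem_zpowers hc ▸ (orderOf_dvd_of_pow_eq_one hu).trans hdvd
  have hχc := monoidHomOfForallMemZpowers_apply_gen hc huc
  refine ⟨c, monoidHomOfForallMemZpowers hc huc, (Subgroup.eq_top_iff' _).2 hc,
    congrArg Units.val hχc, fun x => ?_⟩
  obtain ⟨j, rfl⟩ := Subgroup.mem_zpowers_iff.1 (hc x)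
  rw [map_zpow, hχc, ← zpow_natCast, zpow_comm, zpow_natCast, hu, one_zpow]

theorem IsSphericalSystem.exists_notMem {T : List G} (hT : IsSphericalSystem T) {H : Subgroup G}
    (hH : H ≠ ⊤) : ∃ x ∈ T, x ∉ H := by
  by_contra! hle
  exact hH (top_unique (hT.closure_eq_top ▸ (Subgroup.closure_le H).2 hle))

theorem zpowers_subset_sigmaSet {T : List G} {x : G} (hx : x ∈ T) :
    (Subgroup.zpowers x : Set G) ⊆ sigmaSet T := fun z hz =>
  Set.mem_iUnion.2 ⟨1, Set.mem_iUnion₂.2 ⟨x, hx, z, hz, by simp⟩⟩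

theorem not_admitsRamificationStructure_of_forall_mem_zpowers {H : Subgroup G} (hH : H ≠ ⊤) {z : G}
    (hz : z ≠ 1) (h : ∀ g ∉ H, z ∈ Subgroup.zpowers g) : ¬ AdmitsRamificationStructure G := by
  rintro ⟨_, _, T₁, T₂, hT⟩
  have hmem {T : List G} (hT : IsSphericalSystem T) : z ∈ sigmaSet T := by
    obtain ⟨x, hxT, hxH⟩ := hT.exists_notMem hH
    exact zpowers_subset_sigmaSet hxT (h x hxH)
  exact hz (hT.disjoint.subset ⟨hmem hT.left_spherical, hmem hT.right_spherical⟩)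

end Groups

theorem le_totient_prime_pow_succ {p : ℕ} (hp : p.Prime) (n : ℕ) : n ≤ (p ^ (n + 1)).totient := by
  rw [Nat.totient_prime_pow_succ hp]
  exact (Nat.lt_pow_self hp.one_lt).le.trans
    (Nat.le_mul_of_pos_right _ (Nat.sub_pos_of_lt hp.one_lt))

theorem geom_sum_eq_zero_of_pow_eq_one {R : Type*} [Ring R] [NoZeroDivisors R] {x : R} {n : ℕ}
    (hx : x ≠ 1) (hn : x ^ n = 1) : ∑ i ∈ Finset.range n, x ^ i = 0 :=
  (mul_eq_zero.1 ((geom_sum_mul x n).trans (sub_eq_zero.2 hn))).resolve_right (sub_ne_zero.2 hx)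

theorem addSubgroup_eq_top_of_smul_mem {R M : Type*} [Ring R] [AddCommGroup M] [Module R M] {u : R}
    (hu : Algebra.adjoin ℤ {u} = ⊤) {a : M} (ha : Submodule.span R {a} = ⊤) {A : AddSubgroup M}
    (haA : a ∈ A) (huA : ∀ b ∈ A, u • b ∈ A) : A = ⊤ := by
  have hsmul (r : R) : ∀ b ∈ A, r • b ∈ A := by
    induction hu ▸ (Algebra.mem_top : r ∈ (⊤ : Subalgebra ℤ R)) using Algebra.adjoin_induction with
    | mem r hr => exact hr ▸ huA
    | algebraMap n =>
      intro b hb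
      rw [algebraMap_smul]
      exact A.zsmul_mem hb n
    | add r s _ _ hr hs => exact fun b hb => add_smul r s b ▸ A.add_mem (hr b hb) (hs b hb)
    | mul r s _ _ hr hs => exact fun b hb => mul_smul r s b ▸ hr _ (hs b hb)
  refine (AddSubgroup.eq_top_iff' A).2 fun x => ?_
  obtain ⟨r, rfl⟩ := Submodule.mem_span_singleton.1 (ha ▸ Submodule.mem_top : x ∈ _)
  exact hsmul r a haA

open Multiplicative (ofAdd toAdd)

/-- The action of the units of `R` on the additive group of an `R`-module, which is written
multiplicatively because semidirect products are formed from multiplicative groups. -/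
def unitsMulAut (R M : Type*) [Ring R] [AddCommGroup M] [Module R M] :
    Rˣ →* MulAut (Multiplicative M) :=
  (MulAutMultiplicative M).symm.toMonoidHom.comp (DistribMulAction.toAddAut Rˣ M)

@[simp]
theorem unitsMulAut_apply_ofAdd {R M : Type*} [Ring R] [AddCommGroup M] [Module R M] (u : Rˣ)
    (a : M) : unitsMulAut R M u (ofAdd a) = ofAdd (u • a) :=
  rfl

/-- The split extension of `C` by the additive group of the `R`-module `M`, in which `C` acts on `M`
through scalar multiplication by the values of the character `χ`. -/
abbrev CharacterExtension {R C : Type*} [Ring R] [Group C] (χ : C →* Rˣ) (M : Type*)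
    [AddCommGroup M] [Module R M] : Type _ :=
  Multiplicative M ⋊[(unitsMulAut R M).comp χ] C

namespace CharacterExtension

open SemidirectProduct

section Ring

variable {R C M : Type*} [Ring R] [Group C] {χ : C →* Rˣ} [AddCommGroup M] [Module R M]

instance [Finite M] [Finite C] : Finite (CharacterExtension χ M) :=
  .of_equiv _ equivProd.symm

theorem pow_right (g : CharacterExtension χ M) (n : ℕ) : (g ^ n).right = g.right ^ n :=
  map_pow rightHom g n

theorem pow_left (g : CharacterExtension χ M) (n : ℕ) :
    (g ^ n).left = ofAdd ((∑ i ∈ Finset.range n, (χ g.right : R) ^ i) • toAdd g.left) := by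
  induction n with
  | zero => rw [Finset.sum_range_zero, zero_smul]; rfl
  | succ n ih =>
    rw [pow_succ, mul_left, ih, pow_right, Finset.sum_range_succ, add_smul, ofAdd_add,
      ← Units.val_pow_eq_pow_val, ← map_pow]
    rfl

theorem pow_of_map_right_eq_one {g : CharacterExtension χ M} (hg : χ g.right = 1) (n : ℕ) :
    g ^ n = inl (g.left ^ n) * inr (g.right ^ n) := by
  ext
  · simp [pow_left, hg, Nat.cast_smul_eq_nsmul]
  · simp [pow_right]

theorem pow_of_map_right_ne_one [NoZeroDivisors R] {g : CharacterExtension χ M} {n : ℕ}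
    (hg : χ g.right ≠ 1) (hn : χ g.right ^ n = 1) : g ^ n = inr (g.right ^ n) := by
  have hsum : ∑ i ∈ Finset.range n, (χ g.right : R) ^ i = 0 :=
    geom_sum_eq_zero_of_pow_eq_one (Units.val_eq_one.not.2 hg)
      (by rw [← Units.val_pow_eq_pow_val, hn, Units.val_one])
  ext
  · rw [pow_left, hsum, zero_smul, left_inr, ofAdd_zero]
  · rw [pow_right, right_inr]

theorem range_pow_eq_image_inl [NoZeroDivisors R] {n : ℕ} (hn : ∀ x : C, x ^ n = 1) :
    Set.range (fun g : CharacterExtension χ M => g ^ n) =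
      inl '' Set.range fun a : Multiplicative M => a ^ n := by
  apply Set.Subset.antisymm
  · rintro _ ⟨g, rfl⟩
    dsimp only
    by_cases hg : χ g.right = 1
    · exact ⟨_, ⟨g.left, rfl⟩, by simp [pow_of_map_right_eq_one hg, hn]⟩
    · have hχ : χ g.right ^ n = 1 := by rw [← map_pow, hn, map_one]
      exact ⟨1, ⟨1, one_pow n⟩, by rw [pow_of_map_right_ne_one hg hχ, hn, map_one, map_one]⟩
  · rintro _ ⟨_, ⟨a, rfl⟩, rfl⟩
    exact ⟨inl a, (map_pow inl a n).symm⟩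

theorem ncard_range_pow [NoZeroDivisors R] {n : ℕ} (hn : ∀ x : C, x ^ n = 1) :
    (Set.range fun g : CharacterExtension χ M => g ^ n).ncard =
      (Set.range fun a : M => n • a).ncard := by
  rw [range_pow_eq_image_inl hn]
  exact Set.ncard_image_of_injective _ inl_injective

theorem pow_eq_one [NoZeroDivisors R] {n : ℕ} (hC : ∀ x : C, x ^ n = 1)
    (hM : ∀ a : M, n • a = 0) (g : CharacterExtension χ M) : g ^ n = 1 := by
  obtain ⟨_, ⟨a, rfl⟩, ha⟩ := (range_pow_eq_image_inl hC).subset ⟨g, rfl⟩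
  exact ha.symm.trans ((congrArg inl (congrArg ofAdd (hM (toAdd a)))).trans (map_one inl))

theorem exponent_eq_prime_pow [NoZeroDivisors R] {p l : ℕ} [Fact p.Prime]
    (hC : ∀ x : C, x ^ p ^ l = 1) (hM : ∀ a : M, p ^ (l + 1) • a = 0)
    (hl : 1 < (Set.range fun a : M => p ^ l • a).ncard) :
    Monoid.exponent (CharacterExtension χ M) = p ^ (l + 1) :=
  exponent_eq_prime_pow_of_one_lt_ncard
    (pow_eq_one (fun x => by rw [pow_succ, pow_mul, hC, one_pow]) hM)
    (hl.trans_eq (ncard_range_pow hC).symm)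

theorem not_commute_inl_inr {c : C} {a : M} (h : χ c • a ≠ a) :
    ¬ Commute (inl (ofAdd a) : CharacterExtension χ M) (inr c) := fun hcomm =>
  h (by simpa using (congrArg left hcomm).symm)

theorem closure_inl_inr_eq_top {c : C} (hc : Subgroup.zpowers c = ⊤)
    (hχ : Algebra.adjoin ℤ {(χ c : R)} = ⊤) {a : M} (ha : Submodule.span R {a} = ⊤) :
    Subgroup.closure {inl (ofAdd a), (inr c : CharacterExtension χ M)} = ⊤ := by
  set H := Subgroup.closure {inl (ofAdd a), (inr c : CharacterExtension χ M)}
  have haH : inl (ofAdd a) ∈ H := Subgroup.subset_closure (by simp)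
  have hcH : inr c ∈ H := Subgroup.subset_closure (by simp)
  have hleft : Subgroup.toAddSubgroup' (H.comap inl) = ⊤ := by
    refine addSubgroup_eq_top_of_smul_mem hχ ha haH fun b hb => ?_
    change inl ((unitsMulAut R M).comp χ c (ofAdd b)) ∈ H
    rw [inl_aut, map_inv]
    exact H.mul_mem (H.mul_mem hcH hb) (H.inv_mem hcH)
  have hright : H.comap inr = ⊤ := top_unique (hc ▸ (Subgroup.zpowers_le.2 hcH))
  refine (Subgroup.eq_top_iff' H).2 fun g => ?_
  rw [← inl_left_mul_inr_right g]
  exact H.mul_mem (hleft ▸ AddSubgroup.mem_top (toAdd g.left) :)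
    (hright ▸ Subgroup.mem_top g.right :)

theorem rank_eq_two [Group.FG (CharacterExtension χ M)] {c : C} (hc : Subgroup.zpowers c = ⊤)
    (hχ : Algebra.adjoin ℤ {(χ c : R)} = ⊤) {a : M} (ha : Submodule.span R {a} = ⊤)
    (hne : χ c • a ≠ a) : Group.rank (CharacterExtension χ M) = 2 := by
  classical
  refine le_antisymm ?_ (two_le_rank_of_not_commute (not_commute_inl_inr hne))
  exact (Group.rank_le (S := {inl (ofAdd a), inr c})
    (by simpa using closure_inl_inr_eq_top hc hχ ha)).trans Finset.card_le_two

end Ring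

theorem not_admitsRamificationStructure {R C M : Type*} [Ring R] [NoZeroDivisors R] [CommGroup C]
    [IsCyclic C] [AddCommGroup M] [Module R M] {χ : C →* Rˣ} {p k : ℕ} [Fact p.Prime]
    (hC : Nat.card C = p ^ (k + 1)) (hχ : χ ≠ 1) (hχk : ∀ x, χ x ^ p ^ k = 1) :
    ¬ AdmitsRamificationStructure (CharacterExtension χ M) := by
  obtain ⟨c, hc⟩ := IsCyclic.exists_generator (α := C)
  have hck : c ^ p ^ k ≠ 1 := fun h => by
    have hdvd := orderOf_dvd_of_pow_eq_one h
    rw [orderOf_eq_card_of_forall_mem_zpowers hc, hC,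
      Nat.pow_dvd_pow_iff_le_right (Fact.out : p.Prime).one_lt] at hdvd
    omega
  let H : Subgroup (CharacterExtension χ M) := ((powMonoidHom (p ^ k)).comp rightHom).ker
  refine not_admitsRamificationStructure_of_forall_mem_zpowers (H := H) (z := inr (c ^ p ^ k))
    (fun h => hck (h ▸ Subgroup.mem_top (inr c) : inr c ∈ H))
    (fun h => hck (inr_injective (h.trans (map_one inr).symm))) fun g hg => ?_
  have hright : Subgroup.zpowers g.right = ⊤ := zpowers_eq_top_of_pow_ne_one hC hg
  have hχg : χ g.right ≠ 1 := fun h => hχ <| (MonoidHom.ker_eq_top_iff).1 <|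
    top_unique (hright ▸ Subgroup.zpowers_le.2 h)
  obtain ⟨j, rfl⟩ : ∃ j : ℤ, g.right ^ j = c :=
    Subgroup.mem_zpowers_iff.1 (hright ▸ Subgroup.mem_top c)
  refine ⟨(p ^ k : ℕ) * j, ?_⟩
  simp only [zpow_mul, zpow_natCast, pow_of_map_right_ne_one hχg (hχk _)]
  rw [← map_zpow, ← zpow_natCast, ← zpow_natCast, zpow_comm]

end CharacterExtension

theorem ncard_range_smul_quotient_span_mul {R : Type*} [CommRing R] {a : R} (ha : IsLeftRegular a)
    (b : R) : (Set.range fun x : R ⧸ Ideal.span {a * b} => a • x).ncard =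
      Nat.card (R ⧸ Ideal.span {b}) := by
  let f : R →ₗ[R] R ⧸ Ideal.span {a * b} := (Ideal.span {a * b}).mkQ ∘ₗ LinearMap.mulLeft R a
  have hker : LinearMap.ker f = Ideal.span {b} := by
    ext x
    change Ideal.Quotient.mk _ (a * x) = 0 ↔ _
    rw [Ideal.Quotient.eq_zero_iff_mem, Ideal.mem_span_singleton, Ideal.mem_span_singleton,
      ha.dvd_cancel_left]
  have hrange : (Set.range fun x : R ⧸ Ideal.span {a * b} => a • x) = LinearMap.range f :=
    (Ideal.Quotient.mk_surjective.range_comp _).symm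
  rw [hrange, ← hker]
  exact (Nat.card_congr f.quotKerEquivRange.toEquiv).symm

section Cyclotomic

open NumberField Ideal

variable {p k : ℕ} [Fact p.Prime] {K : Type*} [Field K] [NumberField K]
  [IsCyclotomicExtension {p ^ (k + 1)} ℚ K] {ζ : K} (hζ : IsPrimitiveRoot ζ (p ^ (k + 1)))

include hζ

theorem toInteger_sub_one_pow_totient_dvd_prime :
    (hζ.toInteger - 1) ^ (p ^ (k + 1)).totient ∣ (p : 𝓞 K) := by
  have h := IsCyclotomicExtension.Rat.map_eq_span_zeta_sub_one_pow p k hζ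
  rw [map_span, Set.image_singleton, span_singleton_pow, span_singleton_eq_span_singleton,
    IsCyclotomicExtension.Rat.finrank (p ^ (k + 1)) K] at h
  simpa using h.symm.dvd

theorem card_quotient_span_toInteger_sub_one_pow (m : ℕ) :
    Nat.card (𝓞 K ⧸ span {(hζ.toInteger - 1) ^ m}) = p ^ m := by
  rw [← Submodule.cardQuot_apply, ← absNorm_apply, ← span_singleton_pow, map_pow,
    IsCyclotomicExtension.Rat.absNorm_span_zeta_sub_one]

theorem ncard_range_prime_pow_nsmul (l m : ℕ) :
    (Set.range fun x : 𝓞 K ⧸ span {(p : 𝓞 K) ^ l * (hζ.toInteger - 1) ^ m} => p ^ l • x).ncard =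
      p ^ m := by
  have hreg : IsRegular ((p : 𝓞 K) ^ l) :=
    .of_ne_zero (pow_ne_zero l (Nat.cast_ne_zero.2 (Fact.out : p.Prime).ne_zero))
  rw [← card_quotient_span_toInteger_sub_one_pow hζ m,
    ← ncard_range_smul_quotient_span_mul hreg.left]
  simp only [← Nat.cast_smul_eq_nsmul (𝓞 K), Nat.cast_pow]

theorem prime_pow_succ_nsmul_eq_zero (l : ℕ) {m : ℕ} (hm : m ≤ (p ^ (k + 1)).totient)
    (x : 𝓞 K ⧸ span {(p : 𝓞 K) ^ l * (hζ.toInteger - 1) ^ m}) : p ^ (l + 1) • x = 0 := by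
  have hdvd : (p : 𝓞 K) ^ l * (hζ.toInteger - 1) ^ m ∣ (p : 𝓞 K) ^ (l + 1) := by
    rw [pow_succ (p : 𝓞 K)]
    exact mul_dvd_mul_left _
      ((pow_dvd_pow _ hm).trans (toInteger_sub_one_pow_totient_dvd_prime hζ))
  have hzero := Ideal.Quotient.eq_zero_iff_dvd _ _ |>.2 hdvd
  simp only [map_pow, map_natCast] at hzero
  rw [nsmul_eq_mul, Nat.cast_pow, hzero, zero_mul]

theorem finite_quotient_span_prime_pow_mul (l m : ℕ) :
    Finite (𝓞 K ⧸ span {(p : 𝓞 K) ^ l * (hζ.toInteger - 1) ^ m}) := by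
  refine finiteQuotientOfFreeOfNeBot _ ?_
  simp [hζ.zeta_sub_one_prime.ne_zero, (Fact.out : p.Prime).ne_zero]

theorem toInteger_smul_one_ne_one {l m : ℕ} (hl : l ≠ 0) (hm : m ≠ 0) :
    hζ.toInteger • (1 : 𝓞 K ⧸ span {(p : 𝓞 K) ^ l * (hζ.toInteger - 1) ^ m}) ≠ 1 := by
  intro h
  have hprime : Prime (hζ.toInteger - 1) := hζ.zeta_sub_one_prime
  have hp : hζ.toInteger - 1 ∣ (p : 𝓞 K) :=
    mem_span_singleton.1 (IsCyclotomicExtension.Rat.p_mem_span_zeta_sub_one p k hζ)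
  have hdvd : (p : 𝓞 K) ^ l * (hζ.toInteger - 1) ^ m ∣ hζ.toInteger - 1 := by
    rw [← Ideal.Quotient.eq_zero_iff_dvd, map_sub, map_one, sub_eq_zero]
    simpa [Algebra.smul_def] using h
  have hsq : (hζ.toInteger - 1) ^ 2 ∣ (hζ.toInteger - 1) ^ 1 := by
    rw [sq, pow_one]
    exact (mul_dvd_mul (dvd_pow hp hl) (dvd_pow_self _ hm)).trans hdvd
  exact absurd ((pow_dvd_pow_iff hprime.ne_zero hprime.not_isUnit).1 hsq) (by norm_num)

end Cyclotomic

open NumberField in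
theorem mainTheorem8_general (p : ℕ) (hp : p.Prime) (m : ℕ) (hm : 1 ≤ m) :
    ∃ (G : Type) (_ : Group G) (_ : Finite G),
      IsPGroup p G ∧
      Group.rank G = 2 ∧
      (∃ e : ℕ, 1 ≤ e ∧ Monoid.exponent G = p ^ e ∧
        (Set.range (fun g : G => g ^ p ^ (e - 1))).ncard = p ^ m) ∧
      ¬ AdmitsRamificationStructure G := by
  have : Fact p.Prime := ⟨hp⟩
  let K := CyclotomicField (p ^ (m + 1)) ℚ
  have : IsCyclotomicExtension {p ^ (m + 1)} ℚ K :=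
    CyclotomicField.isCyclotomicExtension (p ^ (m + 1)) ℚ
  have hζ := IsCyclotomicExtension.zeta_spec (p ^ (m + 1)) ℚ K
  let C := Multiplicative (ZMod (p ^ (m + 2)))
  have hC : Nat.card C = p ^ (m + 2) := Nat.card_zmod _
  obtain ⟨c, χ, hc, hχc, hχ⟩ := exists_zpowers_eq_top_and_monoidHom_apply_eq (NeZero.ne _)
    ((pow_dvd_pow p (m + 1).le_succ).trans hC.symm.dvd) hζ.toInteger_isPrimitiveRoot.pow_eq_one
  have hCpow (x : C) : x ^ p ^ (m + 2) = 1 :=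
    orderOf_dvd_iff_pow_eq_one.1 ((orderOf_dvd_natCard x).trans hC.dvd)
  let M := 𝓞 K ⧸ Ideal.span {(p : 𝓞 K) ^ (m + 2) * (hζ.toInteger - 1) ^ m}
  have : Finite M := finite_quotient_span_prime_pow_mul hζ (m + 2) m
  have hcM : χ c • (1 : M) ≠ 1 := by
    rw [Units.smul_def, hχc]
    exact toInteger_smul_one_ne_one hζ (by omega) (by omega)
  have hncard := ncard_range_prime_pow_nsmul hζ (m + 2) m
  have hexp : Monoid.exponent (CharacterExtension χ M) = p ^ (m + 3) :=
    CharacterExtension.exponent_eq_prime_pow hCpow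
      (prime_pow_succ_nsmul_eq_zero hζ (m + 2) (le_totient_prime_pow_succ hp m))
      (hncard ▸ Nat.one_lt_pow (by omega) hp.one_lt)
  have hadjoin : Algebra.adjoin ℤ {(χ c : 𝓞 K)} = ⊤ :=
    hχc ▸ IsCyclotomicExtension.Rat.adjoin_singleton_eq_top hζ
  exact ⟨CharacterExtension χ M, inferInstance, inferInstance,
    fun g => ⟨_, hexp ▸ Monoid.pow_exponent_eq_one g⟩,
    CharacterExtension.rank_eq_two hc hadjoin (Ideal.Quotient.span_singleton_one _) hcM,
    ⟨m + 3, by omega, hexp, (CharacterExtension.ncard_range_pow hCpow).trans hncard⟩,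
    CharacterExtension.not_admitsRamificationStructure hC (fun h => hcM (by simp [h])) hχ⟩

theorem mainTheorem8 (p : ℕ) (hp : p.Prime) (hp5 : 5 ≤ p) (m : ℕ) (hm : 1 ≤ m) :
    ∃ (G : Type) (_ : Group G) (_ : Finite G),
      IsPGroup p G ∧
      Group.rank G = 2 ∧
      (∃ e : ℕ, 1 ≤ e ∧ Monoid.exponent G = p ^ e ∧
        (Set.range (fun g : G => g ^ p ^ (e - 1))).ncard = p ^ m) ∧
      ¬ AdmitsRamificationStructure G :=
  mainTheorem8_general p hp m hm
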